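/- Let $\mathbf k$ be a field and let $(X,d)$ be a path metric space, i.e. a metric space in which the distance between any two points is the infimum of the lengths of the curves joining them. For $a\in\mathbb R$ let $\mathrm{Rips}(X,a)$ be the simplicial complex with vertex set $X$ in which a finite nonempty set $\sigma\subseteq X$ is a simplex if and only if $d(x,y)\le a$ for all distinct $x,y\in\sigma$, and let $H_1(\mathbb{R}\mathrm{ips}(X))$ be the persistence module formed by the simplicial homology spaces $V_a=H_1(\mathrm{Rips}(X,a);\mathbf k)$ and the maps $v_a^b\colon V_a\to V_b$ ($a\le b$) induced by inclusion; put $V_{-\infty}=V_{+\infty}=0$. For a rectangle $R=[p,q]\times[r,s]$ with $-\infty\le p<q\le r<s\le+\infty$, let $$\mu(R)=\dim\frac{\operatorname{im}(v_q^r)\cap\ker(v_r^s)}{\operatorname{im}(v_p^r)\cap\ker(v_r^s)}\in\{0,1,2,\dots,\infty\}$$ be its persistence measure, i.e. the multiplicity of the interval summand supported exactly on $\{q,r\}$ in $V_p\to V_q\to V_r\to V_s$. The persistence diagram is the multiset of those points of the extended plane $[-\infty,+\infty]^2$ that lie in the interior (relative to the extended plane) of some rectangle $R$ with $\mu(R)<\infty$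 (the points where the diagram is defined), each point $x$ being counted with multiplicity $\min\{\mu(R): x\in\operatorname{int}R\}$. Then: 1. for $0<p<q$ the map $H_1(\mathrm{Rips}(X,p))\to H_1(\mathrm{Rips}(X,q))$ is surjective; 2. $\mu(R)=0$ for every such rectangle $R$ that does not meet $\{0\}\times[0,+\infty)$; 3. the persistence diagram of $H_1(\mathbb{R}\mathrm{ips}(X))$ is defined at every point $(b,c)$ of the extended plane with $b<c$ and $b\ne 0$; 4. the persistence diagram of $H_1(\mathbb{R}\mathrm{ips}(X))$ is contained in the vertical line $\{0\}\times[0,+\infty)$. No total boundedness of $X$ is assumed. -/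

import Mathlib

noncomputable section

/-! ### Path metric spaces -/

/-- A metric space is a path metric space if the distance between any two points is the infimum
of the lengths of the curves joining them. The length of a curve is the supremum, over all
subdivisions of the parameter interval, of the sums of distances of consecutive points. -/
def IsPathMetricSpace (X : Type*) [MetricSpace X] : Prop :=
  ∀ x y : X, edist x y = ⨅ γ : Path x y, eVariationOn (γ : unitInterval → X) Set.univ

/-! ### Simplicial homology of abstract simplicial complexes

Oriented simplicial chains on a vertex set `X` with coefficients in `k` are realised inside the
exterior algebra of the free vector space on `X`: the oriented simplex `[x₀, …, xₙ]` is
`x₀ ∧ … ∧ xₙ`, so that permuting the vertices multiplies it by the sign of the permutation. -/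

namespace SimplicialHomology

variable (k : Type*) [Field k] {X : Type*}

/-- The oriented simplex `[v 0, …, v (n - 1)]`. -/
def orientedSimplex {n : ℕ} (v : Fin n → X) : ExteriorAlgebra k (X →₀ k) :=
  ExteriorAlgebra.ιMulti k n (fun i => Finsupp.single (v i) (1 : k))

variable (X) in
/-- The linear form on the free vector space on `X` taking the value `1` at each vertex. -/
def vertexSum : Module.Dual k (X →₀ k) :=
  Finsupp.linearCombination k (fun _ : X => (1 : k))

variable (X) in
/-- The simplicial boundary operator `[x₀, …, xₙ] ↦ ∑ (-1)ⁱ [x₀, …, x̂ᵢ, …, xₙ]`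
(see `boundary_orientedSimplex`), realised as contraction with `vertexSum`. -/
def boundary : ExteriorAlgebra k (X →₀ k) →ₗ[k] ExteriorAlgebra k (X →₀ k) :=
  CliffordAlgebra.contractLeft (vertexSum k X)

lemma orientedSimplex_succ {n : ℕ} (v : Fin (n + 1) → X) :
    orientedSimplex k v = ExteriorAlgebra.ι k (Finsupp.single (v 0) (1 : k)) *
      orientedSimplex k (fun i : Fin n => v i.succ) := by
  unfold orientedSimplex
  rw [ExteriorAlgebra.ιMulti_succ_apply]
  rfl

lemma boundary_ι_mul (x : X) (b : ExteriorAlgebra k (X →₀ k)) :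
    boundary k X (ExteriorAlgebra.ι k (Finsupp.single x (1 : k)) * b) =
      b - ExteriorAlgebra.ι k (Finsupp.single x (1 : k)) * boundary k X b := by
  have h := CliffordAlgebra.contractLeft_ι_mul (Q := (0 : QuadraticForm k (X →₀ k)))
    (vertexSum k X) (Finsupp.single x (1 : k)) b
  have h1 : vertexSum k X (Finsupp.single x (1 : k)) = 1 := by simp [vertexSum]
  rw [h1, one_smul] at h
  exact h

/-- The usual formula for the boundary of an oriented simplex. -/
theorem boundary_orientedSimplex {n : ℕ} (v : Fin (n + 1) → X) :
    boundary k X (orientedSimplex k v) =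
      ∑ i : Fin (n + 1), (-1 : k) ^ (i : ℕ) •
        orientedSimplex k (fun j : Fin n => v (i.succAbove j)) := by
  induction n with
  | zero =>
    have h0 : boundary k X (orientedSimplex k (fun i : Fin 0 => v i.succ)) = 0 := by
      have : orientedSimplex k (fun i : Fin 0 => v i.succ) = 1 :=
        ExteriorAlgebra.ιMulti_zero_apply _
      rw [this]
      exact CliffordAlgebra.contractLeft_one _ _
    rw [orientedSimplex_succ, boundary_ι_mul, h0]
    simp
  | succ n ih =>
    rw [orientedSimplex_succ, boundary_ι_mul, ih, Fin.sum_univ_succ (n := n + 1),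
      sub_eq_add_neg, Finset.mul_sum, ← Finset.sum_neg_distrib]
    congr 1
    · simp
    · refine Finset.sum_congr rfl fun i _ => ?_
      rw [orientedSimplex_succ k (fun j : Fin (n + 1) => v (i.succ.succAbove j))]
      simp [pow_succ]

theorem boundary_boundary (c : ExteriorAlgebra k (X →₀ k)) :
    boundary k X (boundary k X c) = 0 :=
  CliffordAlgebra.contractLeft_contractLeft (Q := (0 : QuadraticForm k (X →₀ k))) _ _

/-- The space of simplicial `n`-chains of `K`, spanned by the oriented `n`-simplices of `K`. -/
def chains (K : AbstractSimplicialComplex X) (n : ℕ) :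
    Submodule k (ExteriorAlgebra k (X →₀ k)) :=
  Submodule.span k
    {c | ∃ v : Fin (n + 1) ↪ X, Finset.univ.map v ∈ K.faces ∧ c = orientedSimplex k v}

/-- The space of simplicial `n`-cycles of `K`. Every `0`-chain is a cycle. -/
def cycles (K : AbstractSimplicialComplex X) : ℕ → Submodule k (ExteriorAlgebra k (X →₀ k))
  | 0 => chains k K 0
  | n + 1 => chains k K (n + 1) ⊓ LinearMap.ker (boundary k X)

/-- The space of simplicial `n`-boundaries of `K`. -/
def boundaries (K : AbstractSimplicialComplex X) (n : ℕ) :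
    Submodule k (ExteriorAlgebra k (X →₀ k)) :=
  (chains k K (n + 1)).map (boundary k X)

theorem boundaries_le_chains (K : AbstractSimplicialComplex X) (n : ℕ) :
    boundaries k K n ≤ chains k K n := by
  unfold boundaries
  rw [Submodule.map_le_iff_le_comap]
  refine Submodule.span_le.2 ?_
  rintro _ ⟨v, hv, rfl⟩
  change boundary k X _ ∈ chains k K n
  rw [boundary_orientedSimplex]
  refine Submodule.sum_mem _ fun i _ => Submodule.smul_mem _ _ (Submodule.subset_span ?_)
  refine ⟨i.succAboveEmb.trans v, ?_, rfl⟩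
  refine (K.isRelLowerSet_faces hv).2 ?_ (by simp)
  intro x hx
  simp only [Finset.mem_map, Finset.mem_univ, true_and] at hx ⊢
  obtain ⟨j, rfl⟩ := hx
  exact ⟨_, rfl⟩

theorem boundaries_le_cycles (K : AbstractSimplicialComplex X) (n : ℕ) :
    boundaries k K n ≤ cycles k K n := by
  cases n with
  | zero => exact boundaries_le_chains k K 0
  | succ n =>
    refine le_inf (boundaries_le_chains k K (n + 1)) ?_
    rintro _ ⟨c, -, rfl⟩
    exact boundary_boundary k c

theorem chains_mono {K L : AbstractSimplicialComplex X} (h : K ≤ L) (n : ℕ) :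
    chains k K n ≤ chains k L n := by
  refine Submodule.span_mono ?_
  rintro _ ⟨v, hv, rfl⟩
  exact ⟨v, h hv, rfl⟩

theorem cycles_mono {K L : AbstractSimplicialComplex X} (h : K ≤ L) (n : ℕ) :
    cycles k K n ≤ cycles k L n := by
  cases n with
  | zero => exact chains_mono k h 0
  | succ n => exact inf_le_inf_right _ (chains_mono k h (n + 1))

theorem boundaries_mono {K L : AbstractSimplicialComplex X} (h : K ≤ L) (n : ℕ) :
    boundaries k K n ≤ boundaries k L n :=
  Submodule.map_mono (chains_mono k h (n + 1))

/-- The `n`-th simplicial homology of `K` with coefficients in `k`: cycles modulo boundaries. -/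
abbrev homology (K : AbstractSimplicialComplex X) (n : ℕ) :=
  cycles k K n ⧸ (boundaries k K n).submoduleOf (cycles k K n)

/-- The map in homology induced by an inclusion of simplicial complexes. -/
def homologyMap {K L : AbstractSimplicialComplex X} (h : K ≤ L) (n : ℕ) :
    homology k K n →ₗ[k] homology k L n :=
  Submodule.mapQ _ _ (Submodule.inclusion (cycles_mono k h n))
    (fun _ hc => boundaries_mono k h n hc)

end SimplicialHomology

/-! ### Persistence modules -/

/-- A persistence module over the real numbers. -/
structure PersistenceModule (k : Type*) [Field k] where
  /-- the vector spaces of the module -/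
  space : ℝ → Type*
  [addCommGroup : ∀ a, AddCommGroup (space a)]
  [module : ∀ a, Module k (space a)]
  /-- the structure maps of the module -/
  map : ∀ {a b : ℝ}, a ≤ b → space a →ₗ[k] space b
  map_self : ∀ (a : ℝ) (x : space a), map (le_refl a) x = x
  map_map : ∀ {a b c : ℝ} (hab : a ≤ b) (hbc : b ≤ c) (x : space a),
    map hbc (map hab x) = map (hab.trans hbc) x

attribute [instance] PersistenceModule.addCommGroup PersistenceModule.module

/-- The `n`-th persistent homology of a filtered simplicial complex. -/
def persistentHomology (k : Type*) [Field k] {X : Type*}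
    (S : ℝ →o AbstractSimplicialComplex X) (n : ℕ) : PersistenceModule k where
  space a := SimplicialHomology.homology k (S a) n
  map h := SimplicialHomology.homologyMap k (S.monotone h) n
  map_self a x := by
    obtain ⟨c, rfl⟩ := Submodule.Quotient.mk_surjective _ x
    rfl
  map_map hab hbc x := by
    obtain ⟨c, rfl⟩ := Submodule.Quotient.mk_surjective _ x
    rfl

/-! ### The Vietoris–Rips complex -/

/-- The Vietoris–Rips complex of parameter `a`: a finite nonempty set of points is a simplex if
its distinct points are at distance at most `a`. For `a ≤ 0` it consists of the vertices alone. -/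
def ripsComplex (X : Type*) [MetricSpace X] (a : ℝ) : AbstractSimplicialComplex X where
  faces := {s | s.Nonempty ∧ (s : Set X).Pairwise fun x y => dist x y ≤ a}
  isRelLowerSet_faces := fun _ hs =>
    ⟨hs.1, fun _ ht htn => ⟨htn, hs.2.mono (Finset.coe_subset.2 ht)⟩⟩
  singleton_mem := fun x => ⟨Finset.singleton_nonempty x, by simp⟩

/-- The Vietoris–Rips filtration of a metric space. -/
def ripsFiltration (X : Type*) [MetricSpace X] : ℝ →o AbstractSimplicialComplex X where
  toFun := ripsComplex X
  monotone' := fun _ _ hab _ hs => ⟨hs.1, hs.2.mono' fun _ _ h => h.trans hab⟩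

/-! ### The persistence measure and the persistence diagram -/

/-- A rectangle `[p, q] × [r, s]` in the extended half-plane, with `-∞ ≤ p < q ≤ r < s ≤ +∞`.
Note that `q` and `r` are then real numbers. -/
structure PersistenceRectangle where
  /-- the left side -/
  p : EReal
  /-- the right side -/
  q : ℝ
  /-- the lower side -/
  r : ℝ
  /-- the upper side -/
  s : EReal
  p_lt_q : p < q
  q_le_r : q ≤ r
  r_lt_s : r < s

/-- The set of points of a rectangle, in the extended plane. -/
def PersistenceRectangle.toSet (R : PersistenceRectangle) : Set (EReal × EReal) :=
  Set.Icc R.p R.q ×ˢ Set.Icc (R.r : EReal) R.s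

namespace PersistenceModule

variable {k : Type*} [Field k] (V : PersistenceModule k)

/-- The image of `V_p → V_r` for an extended parameter `p`, where `V_{-∞} = 0`. -/
def imageFrom (p : EReal) (r : ℝ) : Submodule k (V.space r) :=
  ⨆ (a : ℝ) (_ : (a : EReal) = p) (h : a ≤ r), LinearMap.range (V.map h)

/-- The kernel of `V_r → V_s` for an extended parameter `s`, where `V_{+∞} = 0`. -/
def kernelTo (r : ℝ) (s : EReal) : Submodule k (V.space r) :=
  ⨅ (b : ℝ) (_ : (b : EReal) = s) (h : r ≤ b), LinearMap.ker (V.map h)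

/-- The persistence measure of a rectangle `[p, q] × [r, s]`: the multiplicity of the interval
summand supported exactly on `{q, r}` in the quiver representation `V_p → V_q → V_r → V_s`.
It is the dimension of the space of elements of `V_r` that come from `V_q` and die in `V_s`,
modulo those among them that already come from `V_p`. -/
def measure (R : PersistenceRectangle) : ℕ∞ :=
  Cardinal.toENat (Module.rank k
    (↥(V.imageFrom R.q R.r ⊓ V.kernelTo R.r R.s) ⧸
      (V.imageFrom R.p R.r ⊓ V.kernelTo R.r R.s).submoduleOf
        (V.imageFrom R.q R.r ⊓ V.kernelTo R.r R.s)))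

/-- The part of the extended plane on which the persistence diagram is defined: the points that
are interior (in the extended plane) to a rectangle of finite persistence measure. -/
def diagramDomain : Set (EReal × EReal) :=
  {x | ∃ R : PersistenceRectangle, x ∈ interior R.toSet ∧ V.measure R < ⊤}

/-- The multiplicity of a point: the minimal persistence measure of a rectangle having the point
in its interior. -/
def multiplicity (x : EReal × EReal) : ℕ∞ :=
  ⨅ (R : PersistenceRectangle) (_ : x ∈ interior R.toSet), V.measure R

/-- The set of points occurring in the persistence diagram of `V`, which is the multiset of the
points of `diagramDomain` counted with their (finite) multiplicity. -/
def diagramPoints : Set (EReal × EReal) :=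
  {x | x ∈ V.diagramDomain ∧ V.multiplicity x ≠ 0}

end PersistenceModule

end

/-! An edge of length at most `q` is homologous in `Rips(X, q)` to the path through an approximate
midpoint, whose two edges have length at most `2q/3`. Iterating moves every 1-cycle down to any
positive scale (`exists_chain_rips_of_pos`), hence the surjectivity. Nonpositive scales have no
edges, so `H₁` vanishes there. Thus a rectangle has measure zero as soon as `p > 0` or `q ≤ 0`, and
such rectangles surround every point above the diagonal with `b ≠ 0`.

The delicate point is `(0, +∞)`, since any rectangle around it meets the line. If one has finite
measure, that measure is the dimension of `V_r`. Coning kills each cycle eventually, so finitely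
many generators die at a common `b`; by surjectivity `V_b = 0`, and `[-∞, b] × [b, +∞]` has measure
zero. So the diagram is undefined at `(0, +∞)` or has multiplicity zero there. -/

open SimplicialHomology

/-! ### Approximate midpoints -/

/-- On a nearly shortest curve the intermediate value theorem gives a point at distance exactly
`d(x, y) / 2` from `x`; additivity of length bounds its distance to `y`. -/
theorem IsPathMetricSpace.exists_approx_midpoint {X : Type*} [MetricSpace X]
    (hX : IsPathMetricSpace X) (x y : X) {ε : ℝ} (hε : 0 < ε) :
    ∃ z : X, dist x z ≤ dist x y / 2 + ε ∧ dist z y ≤ dist x y / 2 + ε := by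
  have hlt : (⨅ γ : Path x y, eVariationOn (γ : unitInterval → X) Set.univ) <
      edist x y + ENNReal.ofReal ε := by
    rw [← hX x y]
    exact ENNReal.lt_add_right (edist_ne_top x y) (by simpa using hε)
  obtain ⟨γ, hγ⟩ := iInf_lt_iff.1 hlt
  obtain ⟨t, ht⟩ : ∃ t : unitInterval, dist x (γ t) = dist x y / 2 := by
    have hc : Continuous fun t => dist x (γ t) := by fun_prop
    have h0 : dist x (γ 0) ≤ dist x y / 2 := by
      simpa using div_nonneg (dist_nonneg (x := x) (y := y)) zero_le_two
    have h1 : dist x y / 2 ≤ dist x (γ 1) := by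
      have : 0 ≤ dist x y := dist_nonneg
      simp only [Path.target]
      linarith
    exact mem_range_of_exists_le_of_exists_ge hc ⟨0, h0⟩ ⟨1, h1⟩
  refine ⟨γ t, by rw [ht]; linarith, ?_⟩
  have hsum : edist x (γ t) + edist (γ t) y ≤
      eVariationOn (γ : unitInterval → X) Set.univ := by
    have h1 : edist x (γ t) ≤ eVariationOn γ (Set.Iic t) := by
      simpa using eVariationOn.edist_le γ (s := Set.Iic t) (x := 0) (y := t)
        (Set.mem_Iic.2 t.2.1) Set.self_mem_Iic
    have h2 : edist (γ t) y ≤ eVariationOn γ (Set.Ici t) := by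
      simpa using eVariationOn.edist_le γ (s := Set.Ici t) (x := t) (y := 1)
        Set.self_mem_Ici (Set.mem_Ici.2 t.2.2)
    calc _ ≤ _ := add_le_add h1 h2
      _ ≤ _ := eVariationOn.add_le_union γ fun a ha b hb => le_trans ha hb
      _ ≤ _ := eVariationOn.mono γ (Set.subset_univ _)
  have h := hsum.trans_lt hγ
  rw [edist_dist, edist_dist, edist_dist, ← ENNReal.ofReal_add dist_nonneg dist_nonneg,
    ← ENNReal.ofReal_add dist_nonneg hε.le] at h
  have := (ENNReal.ofReal_lt_ofReal_iff_of_nonneg (by positivity)).1 h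
  linarith

/-! ### Chains of the Vietoris–Rips complex -/

section Chains

variable (k : Type*) [Field k] {X : Type*}

theorem orientedSimplex_eq_zero_of_not_injective {n : ℕ} {v : Fin n → X}
    (hv : ¬ Function.Injective v) : orientedSimplex k v = 0 := by
  obtain ⟨i, j, hij, hne⟩ : ∃ i j, v i = v j ∧ i ≠ j := by
    simpa [Function.Injective] using hv
  exact AlternatingMap.map_eq_zero_of_eq _ _ (by rw [hij]) hne

theorem boundary_triangle (x y z : X) :
    boundary k X (orientedSimplex k ![x, y, z]) =
      orientedSimplex k ![y, z] - orientedSimplex k ![x, z] + orientedSimplex k ![x, y] := by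
  rw [boundary_orientedSimplex, Fin.sum_univ_three]
  have h0 : (fun j : Fin 2 => ![x, y, z] (Fin.succAbove 0 j)) = ![y, z] := by
    ext j; fin_cases j <;> rfl
  have h1 : (fun j : Fin 2 => ![x, y, z] (Fin.succAbove 1 j)) = ![x, z] := by
    ext j; fin_cases j <;> rfl
  have h2 : (fun j : Fin 2 => ![x, y, z] (Fin.succAbove 2 j)) = ![x, y] := by
    ext j; fin_cases j <;> rfl
  rw [h0, h1, h2]
  simp [sub_eq_add_neg]

variable [MetricSpace X]

/-- Degenerate simplices are zero, so a midpoint or a cone apex may coincide with another vertex. -/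
theorem orientedSimplex_mem_chains_rips {n : ℕ} {a : ℝ} {v : Fin (n + 1) → X}
    (hv : ∀ i j, i < j → dist (v i) (v j) ≤ a) :
    orientedSimplex k v ∈ chains k (ripsComplex X a) n := by
  by_cases hinj : Function.Injective v
  · refine Submodule.subset_span ⟨⟨v, hinj⟩, ⟨by simp, ?_⟩, rfl⟩
    intro x hx y hy hxy
    simp only [Finset.coe_map, Finset.coe_univ, Set.image_univ, Set.mem_range,
      Function.Embedding.coeFn_mk] at hx hy
    obtain ⟨i, rfl⟩ := hx
    obtain ⟨j, rfl⟩ := hy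
    rcases lt_trichotomy i j with h | h | h
    · exact hv i j h
    · exact absurd (congrArg v h) hxy
    · rw [dist_comm]
      exact hv j i h
  · rw [orientedSimplex_eq_zero_of_not_injective k hinj]
    exact zero_mem _

theorem dist_le_of_map_mem_rips {n : ℕ} {a : ℝ} {v : Fin n ↪ X}
    (hv : Finset.univ.map v ∈ (ripsComplex X a).faces) {i j : Fin n} (hij : i ≠ j) :
    dist (v i) (v j) ≤ a :=
  hv.2 (by simp) (by simp) (v.injective.ne hij)

theorem ripsComplex_mono {a b : ℝ} (h : a ≤ b) : ripsComplex X a ≤ ripsComplex X b :=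
  (ripsFiltration X).monotone h

theorem exists_chain_rips_two_thirds (hX : IsPathMetricSpace X) {q : ℝ} (hq : 0 < q)
    {c : ExteriorAlgebra k (X →₀ k)} (hc : c ∈ chains k (ripsComplex X q) 1) :
    ∃ c' ∈ chains k (ripsComplex X (2 / 3 * q)) 1,
      c - c' ∈ boundaries k (ripsComplex X q) 1 := by
  induction hc using Submodule.span_induction with
  | mem c hc =>
    obtain ⟨v, hv, rfl⟩ := hc
    -- The choice of `ε` gives `q / 2 + q / 6 = 2 / 3 * q`.
    obtain ⟨z, hz0, hz1⟩ := hX.exists_approx_midpoint (v 0) (v 1) (ε := q / 6) (by positivity)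
    have hd : dist (v 0) (v 1) ≤ q := dist_le_of_map_mem_rips hv (by decide)
    have hv' : (v : Fin 2 → X) = ![v 0, v 1] := by ext j; fin_cases j <;> rfl
    refine ⟨orientedSimplex k ![v 0, z] + orientedSimplex k ![z, v 1],
      add_mem (orientedSimplex_mem_chains_rips k ?_) (orientedSimplex_mem_chains_rips k ?_),
      -orientedSimplex k ![v 0, z, v 1],
      neg_mem (orientedSimplex_mem_chains_rips k ?_), ?_⟩
    · simp [Fin.forall_fin_two]; linarith
    · simp [Fin.forall_fin_two]; linarith
    · simp [Fin.forall_fin_succ]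
      exact ⟨⟨by linarith, hd⟩, by linarith⟩
    · rw [map_neg, boundary_triangle, hv']
      simp only [Matrix.cons_val_zero, Matrix.cons_val_one]
      abel
  | zero => exact ⟨0, zero_mem _, by simp⟩
  | add c d _ _ hc hd =>
    obtain ⟨c', hc', h⟩ := hc
    obtain ⟨d', hd', h'⟩ := hd
    refine ⟨c' + d', add_mem hc' hd', ?_⟩
    rw [add_sub_add_comm]
    exact add_mem h h'
  | smul t c _ hc =>
    obtain ⟨c', hc', h⟩ := hc
    refine ⟨t • c', Submodule.smul_mem _ t hc', ?_⟩
    rw [← smul_sub]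
    exact Submodule.smul_mem _ t h

/-- Each subdivision shrinks the scale by `2 / 3`; the successive homologies all live in `Rips(X,
q)`. -/
theorem exists_chain_rips_of_pos (hX : IsPathMetricSpace X) {p q : ℝ} (hp : 0 < p)
    {c : ExteriorAlgebra k (X →₀ k)} (hc : c ∈ chains k (ripsComplex X q) 1) :
    ∃ c' ∈ chains k (ripsComplex X p) 1, c - c' ∈ boundaries k (ripsComplex X q) 1 := by
  obtain ⟨n, hn⟩ : ∃ n : ℕ, q ≤ (3 / 2 : ℝ) ^ n * p := by
    obtain ⟨n, hn⟩ := pow_unbounded_of_one_lt (q / p) (by norm_num : (1 : ℝ) < 3 / 2)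
    exact ⟨n, ((div_lt_iff₀ hp).1 hn).le⟩
  induction n generalizing q c with
  | zero =>
    exact ⟨c, chains_mono k (ripsComplex_mono (by simpa using hn)) 1 hc, by simp⟩
  | succ n ih =>
    rcases le_or_gt q p with h | h
    · exact ⟨c, chains_mono k (ripsComplex_mono h) 1 hc, by simp⟩
    · obtain ⟨d, hd, hcd⟩ := exists_chain_rips_two_thirds k hX (hp.trans h) hc
      obtain ⟨c', hc', hdc⟩ := ih hd (by rw [pow_succ] at hn; linarith)
      refine ⟨c', hc', ?_⟩
      rw [← sub_add_sub_cancel c d c']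
      exact add_mem hcd (boundaries_mono k (ripsComplex_mono (by linarith)) 1 hdc)

theorem chains_one_rips_eq_bot {a : ℝ} (ha : a ≤ 0) : chains k (ripsComplex X a) 1 = ⊥ := by
  refine Submodule.span_eq_bot.2 ?_
  rintro _ ⟨v, hv, rfl⟩
  have h := (dist_le_of_map_mem_rips hv (by decide : (0 : Fin 2) ≠ 1)).trans ha
  exact absurd (v.injective (dist_le_zero.1 h)) (by decide)

/-- The cone from a vertex over a `1`-chain is a chain of a large enough Rips complex. -/
theorem exists_cone_mem_chains_rips (w : X) {a : ℝ} {c : ExteriorAlgebra k (X →₀ k)}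
    (hc : c ∈ chains k (ripsComplex X a) 1) :
    ∃ b : ℝ, ExteriorAlgebra.ι k (Finsupp.single w (1 : k)) * c ∈
      chains k (ripsComplex X b) 2 := by
  induction hc using Submodule.span_induction with
  | mem c hc =>
    obtain ⟨v, hv, rfl⟩ := hc
    refine ⟨max (dist w (v 0)) (max (dist w (v 1)) (dist (v 0) (v 1))), ?_⟩
    have h : ExteriorAlgebra.ι k (Finsupp.single w (1 : k)) * orientedSimplex k v =
        orientedSimplex k (Fin.cons w v : Fin 3 → X) := by
      rw [orientedSimplex_succ k (Fin.cons w v : Fin 3 → X)]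
      simp only [Fin.cons_zero, Fin.cons_succ]
    rw [h]
    refine orientedSimplex_mem_chains_rips k fun i j hij => ?_
    fin_cases i <;> fin_cases j <;> first | exact absurd hij (by decide) | skip
    · exact le_max_left _ _
    · exact (le_max_left _ _).trans (le_max_right _ _)
    · exact (le_max_right _ _).trans (le_max_right _ _)
  | zero => exact ⟨0, by simp⟩
  | add c d _ _ hc hd =>
    obtain ⟨b, hb⟩ := hc
    obtain ⟨b', hb'⟩ := hd
    refine ⟨max b b', ?_⟩
    rw [mul_add]
    exact add_mem (chains_mono k (ripsComplex_mono (le_max_left _ _)) 2 hb)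
      (chains_mono k (ripsComplex_mono (le_max_right _ _)) 2 hb')
  | smul t c _ hc =>
    obtain ⟨b, hb⟩ := hc
    refine ⟨b, ?_⟩
    rw [mul_smul_comm]
    exact Submodule.smul_mem _ t hb

/-- For a cycle `c` and a vertex `w`, `∂(w ∧ c) = c - w ∧ ∂c = c`. An empty `X` offers no apex and
is treated apart. -/
theorem exists_mem_boundaries_rips {a : ℝ} {c : ExteriorAlgebra k (X →₀ k)}
    (hc : c ∈ cycles k (ripsComplex X a) 1) :
    ∃ b : ℝ, c ∈ boundaries k (ripsComplex X b) 1 := by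
  rcases isEmpty_or_nonempty X with hE | ⟨⟨w⟩⟩
  · have h : chains k (ripsComplex X a) 1 = ⊥ := by
      refine Submodule.span_eq_bot.2 ?_
      rintro _ ⟨v, -, rfl⟩
      exact hE.elim (v 0)
    have hc0 : c = 0 := by simpa [h] using hc.1
    exact ⟨0, hc0 ▸ zero_mem _⟩
  · obtain ⟨b, hb⟩ := exists_cone_mem_chains_rips k w hc.1
    refine ⟨b, _, hb, ?_⟩
    rw [boundary_ι_mul, show boundary k X c = 0 from hc.2]
    simp

/-! ### Persistent first homology of the Vietoris–Rips filtration -/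

theorem map_rips_surjective (hX : IsPathMetricSpace X) {p q : ℝ} (hp : 0 < p) (hpq : p ≤ q) :
    Function.Surjective ((persistentHomology k (ripsFiltration X) 1).map hpq) := by
  intro x
  obtain ⟨⟨c, hc⟩, rfl⟩ := Submodule.Quotient.mk_surjective _ x
  obtain ⟨c', hc', h⟩ := exists_chain_rips_of_pos k hX hp hc.1
  have hb : boundary k X c' = 0 := by
    have h1 : boundary k X (c - c') = 0 := (boundaries_le_cycles k _ 1 h).2
    rwa [map_sub, show boundary k X c = 0 from hc.2, zero_sub, neg_eq_zero] at h1
  refine ⟨Submodule.Quotient.mk ⟨c', hc', hb⟩, ((Submodule.Quotient.eq _).2 ?_).symm⟩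
  exact h

theorem rips_space_subsingleton {a : ℝ} (ha : a ≤ 0) :
    Subsingleton ((persistentHomology k (ripsFiltration X) 1).space a) := by
  refine subsingleton_of_forall_eq 0 fun x => ?_
  obtain ⟨⟨c, hc⟩, rfl⟩ := Submodule.Quotient.mk_surjective _ x
  have h : c = 0 := by
    have := hc.1
    rw [show chains k (ripsFiltration X a) 1 = ⊥ from chains_one_rips_eq_bot k ha] at this
    simpa using this
  subst h
  rfl

theorem exists_map_rips_eq_zero {a : ℝ}
    (x : (persistentHomology k (ripsFiltration X) 1).space a) :
    ∃ (b : ℝ) (hab : a ≤ b), (persistentHomology k (ripsFiltration X) 1).map hab x = 0 := by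
  obtain ⟨⟨c, hc⟩, rfl⟩ := Submodule.Quotient.mk_surjective _ x
  obtain ⟨b, hb⟩ := exists_mem_boundaries_rips k hc
  refine ⟨max a b, le_max_left _ _, (Submodule.Quotient.mk_eq_zero _).2 ?_⟩
  exact boundaries_mono k (ripsComplex_mono (le_max_right a b)) 1 hb

end Chains

/-! ### Persistence measures -/

namespace PersistenceModule

variable {k : Type*} [Field k] (V : PersistenceModule k)

theorem imageFrom_coe {a r : ℝ} (h : a ≤ r) : V.imageFrom a r = LinearMap.range (V.map h) := by
  refine le_antisymm (iSup_le fun b => iSup_le fun hb => iSup_le fun hbr => ?_) ?_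
  · obtain rfl := EReal.coe_injective hb
    exact le_rfl
  · exact le_iSup_of_le a (le_iSup_of_le rfl (le_iSup_of_le h le_rfl))

theorem kernelTo_top (r : ℝ) : V.kernelTo r ⊤ = ⊤ := by
  simp [kernelTo]

theorem imageFrom_coe_eq_top {a r : ℝ} (h : a ≤ r) (hs : Function.Surjective (V.map h)) :
    V.imageFrom a r = ⊤ := by
  rw [V.imageFrom_coe h, LinearMap.range_eq_top.2 hs]

/-- The inclusion makes the denominator of the quotient defining the measure the whole numerator. -/
theorem measure_eq_zero_of_le {R : PersistenceRectangle}
    (h : V.imageFrom R.q R.r ≤ V.imageFrom R.p R.r) : V.measure R = 0 := by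
  have htop : (V.imageFrom R.p R.r ⊓ V.kernelTo R.r R.s).submoduleOf
      (V.imageFrom R.q R.r ⊓ V.kernelTo R.r R.s) = ⊤ :=
    Submodule.comap_subtype_eq_top.2 (inf_le_inf_right _ h)
  unfold measure
  rw [htop, rank_subsingleton']
  simp

theorem measure_eq_zero_of_subsingleton {R : PersistenceRectangle}
    (h : Subsingleton (V.space R.q)) : V.measure R = 0 := by
  refine V.measure_eq_zero_of_le ?_
  rw [V.imageFrom_coe R.q_le_r]
  rintro _ ⟨x, rfl⟩
  rw [Subsingleton.elim x 0, map_zero]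
  exact zero_mem _

theorem measure_eq_zero_of_surjective {R : PersistenceRectangle} {p : ℝ} (hp : (p : EReal) = R.p)
    (hpq : p ≤ R.q) (h : Function.Surjective (V.map hpq)) : V.measure R = 0 := by
  refine V.measure_eq_zero_of_le ?_
  rw [← hp, V.imageFrom_coe R.q_le_r, V.imageFrom_coe (hpq.trans R.q_le_r)]
  rintro _ ⟨x, rfl⟩
  obtain ⟨y, rfl⟩ := h x
  exact ⟨y, (V.map_map _ _ y).symm⟩

/-- If the rectangle has infinite upper side and finite measure, and nothing in `V_r` comes from
`V_p` while everything comes from `V_q`, then `V_r` is finite-dimensional. -/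
theorem finite_of_measure_lt_top {R : PersistenceRectangle} (hs : R.s = ⊤)
    (hp : V.imageFrom R.p R.r = ⊥) (hq : V.imageFrom R.q R.r = ⊤) (h : V.measure R < ⊤) :
    Module.Finite k (V.space R.r) := by
  unfold measure at h
  rw [hs, V.kernelTo_top, hp, hq] at h
  rw [inf_top_eq, inf_top_eq, lt_top_iff_ne_top, Ne, Cardinal.toENat_eq_top, not_le,
    Module.rank_lt_aleph0_iff] at h
  have e : (↥(⊤ : Submodule k (V.space R.r)) ⧸
      (⊥ : Submodule k (V.space R.r)).submoduleOf ⊤) ≃ₗ[k] V.space R.r :=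
    (Submodule.quotEquivOfEqBot _ (by
      rw [Submodule.submoduleOf, Submodule.comap_bot, Submodule.ker_subtype])).trans
      Submodule.topEquiv
  exact Module.Finite.equiv e

/-- If every element of a finite-dimensional `V_a` dies, they all die at a common time. -/
theorem exists_map_eq_zero_of_finite {a : ℝ} [Module.Finite k (V.space a)]
    (h : ∀ x : V.space a, ∃ (b : ℝ) (hab : a ≤ b), V.map hab x = 0) :
    ∃ (b : ℝ) (hab : a ≤ b), V.map hab = 0 := by
  obtain ⟨S, hS⟩ := Module.Finite.fg_top (R := k) (M := V.space a)
  choose b hab hb using h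
  obtain ⟨B, hB⟩ := (S.image b).bddAbove
  refine ⟨max a B, le_max_left _ _, LinearMap.ext_on hS fun x hx => ?_⟩
  have hxB : b x ≤ max a B :=
    (hB (Finset.mem_coe.2 (Finset.mem_image_of_mem b hx))).trans (le_max_right _ _)
  rw [← V.map_map (hab x) hxB, hb, map_zero, LinearMap.zero_apply]

end PersistenceModule

/-! ### Interiors of rectangles in the extended plane -/

/-- Half-lines such as `[-∞, q)` and `(r, +∞]` are open in `EReal`, so no strict inequality is
needed at an infinite side. -/
theorem mem_interior_rectangle {R : PersistenceRectangle} (hs : R.s = ⊤) {x : EReal × EReal}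
    (hp : R.p = ⊥ ∨ R.p < x.1) (hq : x.1 < R.q) (hr : (R.r : EReal) < x.2) :
    x ∈ interior R.toSet := by
  rw [PersistenceRectangle.toSet, interior_prod_eq]
  constructor
  · rcases hp with hp | hp
    · rw [hp, Set.Icc_bot]
      exact interior_maximal Set.Iio_subset_Iic_self isOpen_Iio hq
    · exact interior_maximal Set.Ioo_subset_Icc_self isOpen_Ioo ⟨hp, hq⟩
  · rw [hs, Set.Icc_top]
    exact interior_maximal Set.Ioi_subset_Ici_self isOpen_Ioi hr

theorem lt_of_mem_interior_rectangle {R : PersistenceRectangle} {x : EReal × EReal}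
    (hx : x ∈ interior R.toSet) : x.1 < R.q := by
  rw [PersistenceRectangle.toSet, interior_prod_eq] at hx
  have h1 := interior_mono Set.Icc_subset_Iic_self hx.1
  rwa [interior_Iic' ⟨⊤, EReal.coe_lt_top _⟩] at h1

/-! ### Measures of rectangles for the Rips filtration -/

section Rips

variable (k : Type*) [Field k] {X : Type*} [MetricSpace X]

/-- At `p = -∞` the supremum is empty; at a real `p ≤ 0` the source space is zero. -/
theorem imageFrom_rips_eq_bot {p : EReal} (hp : p ≤ 0) (r : ℝ) :
    (persistentHomology k (ripsFiltration X) 1).imageFrom p r = ⊥ := by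
  refine iSup_eq_bot.2 fun a => iSup_eq_bot.2 fun ha => iSup_eq_bot.2 fun har => ?_
  have : Subsingleton ((persistentHomology k (ripsFiltration X) 1).space a) :=
    rips_space_subsingleton k (by rw [← ha] at hp; exact_mod_cast hp)
  rw [LinearMap.range_eq_bot]
  ext x
  rw [Subsingleton.elim x 0, map_zero, map_zero]

theorem measure_rips_eq_zero_of_nonpos {R : PersistenceRectangle} (hq : R.q ≤ 0) :
    (persistentHomology k (ripsFiltration X) 1).measure R = 0 :=
  PersistenceModule.measure_eq_zero_of_subsingleton _ (rips_space_subsingleton k hq)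

theorem measure_rips_eq_zero_of_pos (hX : IsPathMetricSpace X) {R : PersistenceRectangle}
    (hp : 0 < R.p) : (persistentHomology k (ripsFiltration X) 1).measure R = 0 := by
  have hR := R.p_lt_q
  have hp' : ((R.p.toReal : ℝ) : EReal) = R.p :=
    EReal.coe_toReal (hR.trans (EReal.coe_lt_top _)).ne (bot_le.trans_lt hp).ne'
  rw [← hp'] at hp hR
  exact PersistenceModule.measure_eq_zero_of_surjective _ hp' (EReal.coe_lt_coe_iff.1 hR).le
    (map_rips_surjective k hX (EReal.coe_pos.1 hp) _)

theorem exists_measure_rips_eq_zero (hX : IsPathMetricSpace X) {x : EReal × EReal}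
    (hx : x.1 < x.2) (h0 : x.1 ≠ 0) : ∃ R : PersistenceRectangle, x ∈ interior R.toSet ∧
      (persistentHomology k (ripsFiltration X) 1).measure R = 0 := by
  rcases h0.lt_or_gt with h | h
  -- Left of the line, `q` must be below both `0` and `x.2`.
  · obtain ⟨q, hq, hq'⟩ := EReal.lt_iff_exists_real_btwn.1 (lt_min h hx)
    rw [lt_min_iff] at hq'
    refine ⟨⟨⊥, q, q, ⊤, EReal.bot_lt_coe _, le_rfl, EReal.coe_lt_top _⟩,
      mem_interior_rectangle rfl (Or.inl rfl) hq hq'.2,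
      measure_rips_eq_zero_of_nonpos k (EReal.coe_neg'.1 hq'.1).le⟩
  · obtain ⟨q, hq, hq'⟩ := EReal.lt_iff_exists_real_btwn.1 hx
    obtain ⟨p, hp, hp'⟩ := exists_between h
    exact ⟨⟨p, q, q, ⊤, hp'.trans hq, le_rfl, EReal.coe_lt_top _⟩,
      mem_interior_rectangle rfl (Or.inr hp') hq hq', measure_rips_eq_zero_of_pos k hX hp⟩

/-- If some rectangle around `(0, ∞)` has finite measure, then a smaller one has measure zero. -/
theorem exists_measure_rips_eq_zero_at_top (hX : IsPathMetricSpace X) {x : EReal × EReal}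
    (h1 : x.1 = 0) (h2 : x.2 = ⊤)
    (hx : x ∈ (persistentHomology k (ripsFiltration X) 1).diagramDomain) :
    ∃ R : PersistenceRectangle, x ∈ interior R.toSet ∧
      (persistentHomology k (ripsFiltration X) 1).measure R = 0 := by
  obtain ⟨R, hR, hfin⟩ := hx
  have hmem := interior_subset hR
  have hp : R.p ≤ 0 := h1 ▸ hmem.1.1
  have hs : R.s = ⊤ := top_le_iff.1 (h2 ▸ hmem.2.2)
  have hq : 0 < R.q := by
    have := lt_of_mem_interior_rectangle hR
    rw [h1] at this
    exact EReal.coe_pos.1 this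
  have hr : 0 < R.r := hq.trans_le R.q_le_r
  -- Since `p ≤ 0 < q`, nothing in `V_r` comes from `V_p` and everything comes from `V_q`.
  have := PersistenceModule.finite_of_measure_lt_top _ hs (imageFrom_rips_eq_bot k hp R.r)
    (PersistenceModule.imageFrom_coe_eq_top _ R.q_le_r (map_rips_surjective k hX hq _)) hfin
  obtain ⟨b, hb, hb0⟩ :=
    PersistenceModule.exists_map_eq_zero_of_finite _ (exists_map_rips_eq_zero k (X := X) (a := R.r))
  have hsub : Subsingleton ((persistentHomology k (ripsFiltration X) 1).space b) := by
    refine subsingleton_of_forall_eq 0 fun y => ?_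
    obtain ⟨z, rfl⟩ := map_rips_surjective k hX hr hb y
    rw [hb0, LinearMap.zero_apply]
  refine ⟨⟨⊥, b, b, ⊤, EReal.bot_lt_coe _, le_rfl, EReal.coe_lt_top _⟩,
    mem_interior_rectangle rfl (Or.inl rfl) ?_ ?_,
    PersistenceModule.measure_eq_zero_of_subsingleton _ hsub⟩
  · rw [h1]
    exact EReal.coe_pos.2 (hr.trans_le hb)
  · rw [h2]
    exact EReal.coe_lt_top b

end Rips

theorem mainTheorem9 (k : Type*) [Field k] (X : Type*) [MetricSpace X]
    (hX : IsPathMetricSpace X) :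
    -- the map `H₁(Rips(X, p)) → H₁(Rips(X, q))` is surjective for `0 < p < q`
    (∀ p q : ℝ, 0 < p → ∀ hpq : p < q,
      Function.Surjective ((persistentHomology k (ripsFiltration X) 1).map hpq.le)) ∧
    -- the persistence measure vanishes on every rectangle not meeting `{0} × [0, +∞)`
    (∀ R : PersistenceRectangle,
      Disjoint R.toSet (({0} : Set EReal) ×ˢ Set.Ico (0 : EReal) ⊤) →
        (persistentHomology k (ripsFiltration X) 1).measure R = 0) ∧
    -- the persistence diagram is defined at the points off the vertical line over `0`
    (∀ x : EReal × EReal, x.1 < x.2 → x.1 ≠ 0 →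
      x ∈ (persistentHomology k (ripsFiltration X) 1).diagramDomain) ∧
    -- the persistence diagram is contained in `{0} × [0, +∞)`
    (persistentHomology k (ripsFiltration X) 1).diagramPoints ⊆
      ({0} : Set EReal) ×ˢ Set.Ico (0 : EReal) ⊤ := by
  refine ⟨fun p q hp hpq => map_rips_surjective k hX hp hpq.le, fun R hR => ?_,
    fun x hx h0 => ?_, fun x hx => ?_⟩
  · rcases lt_or_ge R.q 0 with hq | hq
    · exact measure_rips_eq_zero_of_nonpos k hq.le
    · refine measure_rips_eq_zero_of_pos k hX (lt_of_not_ge fun hp => ?_)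
      -- If `p ≤ 0 ≤ q`, the point `(0, r)` of the lower side lies on the forbidden line.
      refine Set.disjoint_left.1 hR (?_ : ((0 : EReal), (R.r : EReal)) ∈ _) ?_
      · exact ⟨⟨hp, EReal.coe_nonneg.2 hq⟩, le_rfl, R.r_lt_s.le⟩
      · exact ⟨rfl, EReal.coe_nonneg.2 (hq.trans R.q_le_r), EReal.coe_lt_top _⟩
  · obtain ⟨R, hR, h⟩ := exists_measure_rips_eq_zero k hX hx h0
    exact ⟨R, hR, by simp [h]⟩
  · obtain ⟨hdom, hmult⟩ := hx
    have hne : ∀ R : PersistenceRectangle, x ∈ interior R.toSet →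
        (persistentHomology k (ripsFiltration X) 1).measure R ≠ 0 := fun R hR h =>
      hmult (le_antisymm (iInf₂_le_of_le R hR h.le) bot_le)
    obtain ⟨R, hR, -⟩ := id hdom
    -- Points of the domain lie above the diagonal: `x.1 < q ≤ r ≤ x.2`.
    have hlt : x.1 < x.2 := (lt_of_mem_interior_rectangle hR).trans_le
      ((EReal.coe_le_coe_iff.2 R.q_le_r).trans (interior_subset hR).2.1)
    have h0 : x.1 = 0 := by
      by_contra h0
      obtain ⟨R', hR', h⟩ := exists_measure_rips_eq_zero k hX hlt h0
      exact hne R' hR' h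
    refine ⟨h0, h0 ▸ hlt.le, lt_top_iff_ne_top.2 fun htop => ?_⟩
    obtain ⟨R', hR', h⟩ := exists_measure_rips_eq_zero_at_top k hX h0 htop hdom
    exact hne R' hR' h
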